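/- Let $G$ be a finite group. Let $\mathrm{Or}(G)$ be the orbit category: its objects are the transitive $G$-sets $G/H$, one for each subgroup $H\le G$, and its morphisms are the $G$-equivariant maps. Let $\Omega_{\mathbb{Q}}(G)$ be the rational Mackey category: its objects are the finite $G$-sets, $\mathrm{Hom}(X,Y)$ is $\mathbb{Q}$ tensored with the Grothendieck group (with respect to disjoint union) of isomorphism classes of spans $X\leftarrow V\to Y$ of finite $G$-sets, and composition is the bilinear extension of the pullback of spans. For a $\mathbb{Q}$-linear category $\mathcal{C}$ with finitely many objects, its category algebra is $\bigoplus_{c,d}\mathrm{Hom}_{\mathcal{C}}(c,d)$ with multiplication the bilinear extension of $g\cdot f=g\circ f$ if $g$ and $f$ are composable and $g\cdot f=0$ otherwise. Let $\mathbb{Q}\mathrm{Or}(G)$ be the category algebra of the free $\mathbb{Q}$-linear category on $\mathrm{Or}(G)$, and let the rational Mackey algebra $\mu_{\mathbb{Q}}(G)$ be the category algebra of the full subcategory of $\Omega_{\mathbb{Q}}(G)$ on the objects $G/H$, one for each $H\le G$. The functor $I\colon\mathrm{Or}(G)\to\Omega_{\mathbb{Q}}(G)$ with $I(G/H)=G/H$,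 which sends $f\colon G/H\to G/K$ to the class of the span $G/H\xleftarrow{\mathrm{id}}G/H\xrightarrow{f}G/K$, induces a ring homomorphism $I\colon\mathbb{Q}\mathrm{Or}(G)\to\mu_{\mathbb{Q}}(G)$, and $\mu_{\mathbb{Q}}(G)$ is a left $\mathbb{Q}\mathrm{Or}(G)$-module via $a\cdot m=I(a)m$. Then $\mu_{\mathbb{Q}}(G)$ is a projective left $\mathbb{Q}\mathrm{Or}(G)$-module. -/

import Mathlib

open CategoryTheory

universe u

/-! ### The category algebra of a preadditive category with finitely many objects -/

/-- The category algebra `⨁_{i,j} Hom(i,j)` of the category which has the elements of a finite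
type `ι` as objects and the morphisms `obj i ⟶ obj j` of a preadditive category `D` as morphisms
from `i` to `j`. For `D` with finitely many objects and `obj = id` this is the category algebra
of `D`; in general it is that of a full subcategory on a finite family of objects. As there are
only finitely many pairs `(i,j)`, an element of the direct sum is just a family of morphisms
`a i j : obj i ⟶ obj j`. -/
def CategoryAlgebra {ι D : Type*} [Category D] (obj : ι → D) : Type _ :=
  ∀ i j : ι, obj i ⟶ obj j

namespace CategoryAlgebra

variable {ι D : Type*} [Category D] {obj : ι → D}

@[ext]
theorem ext {a b : CategoryAlgebra obj} (h : ∀ i j, a i j = b i j) : a = b :=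
  funext fun i => funext fun j => h i j

variable [Preadditive D]

instance instAddCommGroup : AddCommGroup (CategoryAlgebra obj) :=
  inferInstanceAs (AddCommGroup (∀ i j : ι, obj i ⟶ obj j))

instance instModule {k : Type*} [CommRing k] [Linear k D] : Module k (CategoryAlgebra obj) :=
  inferInstanceAs (Module k (∀ i j : ι, obj i ⟶ obj j))

@[simp] theorem zero_apply (i j : ι) : (0 : CategoryAlgebra obj) i j = 0 := rfl

@[simp] theorem add_apply (a b : CategoryAlgebra obj) (i j : ι) :
    (a + b) i j = a i j + b i j := rfl

@[simp] theorem smul_apply {k : Type*} [CommRing k] [Linear k D] (r : k)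
    (a : CategoryAlgebra obj) (i j : ι) : (r • a) i j = r • a i j := rfl

open Classical in
/-- The sum of all identity morphisms. -/
noncomputable instance instOne : One (CategoryAlgebra obj) :=
  ⟨fun i j => if h : i = j then eqToHom (congrArg obj h) else 0⟩

theorem one_apply_self (i : ι) : (1 : CategoryAlgebra obj) i i = 𝟙 (obj i) :=
  dif_pos rfl

theorem one_apply_ne {i j : ι} (h : i ≠ j) : (1 : CategoryAlgebra obj) i j = 0 :=
  dif_neg h

variable [Fintype ι]

/-- The bilinear extension of `g * f = g ∘ f` if `g` and `f` are composable, and `g * f = 0`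
otherwise. -/
instance instMul : Mul (CategoryAlgebra obj) :=
  ⟨fun g f i j => ∑ x, f i x ≫ g x j⟩

theorem mul_apply (g f : CategoryAlgebra obj) (i j : ι) :
    (g * f) i j = ∑ x, f i x ≫ g x j := rfl

noncomputable instance instRing : Ring (CategoryAlgebra obj) where
  __ := instAddCommGroup
  __ := instOne
  __ := instMul
  left_distrib a b c := by
    ext x y
    simp [mul_apply, Preadditive.add_comp, Finset.sum_add_distrib]
  right_distrib a b c := by
    ext x y
    simp [mul_apply, Preadditive.comp_add, Finset.sum_add_distrib]
  zero_mul a := by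
    ext x y
    simp [mul_apply]
  mul_zero a := by
    ext x y
    simp [mul_apply]
  mul_assoc a b c := by
    ext x y
    simp only [mul_apply, Preadditive.comp_sum, Preadditive.sum_comp, Category.assoc]
    rw [Finset.sum_comm]
  one_mul a := by
    ext x y
    rw [mul_apply, Finset.sum_eq_single y]
    · simp [one_apply_self]
    · intro z _ hz
      simp [one_apply_ne hz]
    · simp
  mul_one a := by
    ext x y
    rw [mul_apply, Finset.sum_eq_single x]
    · simp [one_apply_self]
    · intro z _ hz
      simp [one_apply_ne hz.symm]
    · simp

noncomputable instance instAlgebra {k : Type*} [CommRing k] [Linear k D] :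
    Algebra k (CategoryAlgebra obj) :=
  Algebra.ofModule
    (fun r a b => by
      ext x y
      simp [mul_apply, Finset.smul_sum])
    (fun r a b => by
      ext x y
      simp [mul_apply, Finset.smul_sum])

end CategoryAlgebra

/-! ### The orbit category -/

/-- The objects of the orbit category `Or(G)`: one transitive `G`-set `G/H` for every subgroup
`H` of `G`. -/
structure Orb (G : Type u) [Group G] : Type u where
  /-- The subgroup `H` of the object `G/H`. -/
  sub : Subgroup G

namespace Orb

variable {G : Type u} [Group G]

instance instFinite [Finite G] : Finite (Orb G) :=
  Finite.of_injective Orb.sub fun a b h => by cases a; cases b; cases h; rfl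

noncomputable instance instFintype [Finite G] : Fintype (Orb G) := Fintype.ofFinite _

/-- The morphisms of the orbit category are the `G`-equivariant maps `G/H → G/K`. -/
instance instCategory : Category (Orb G) where
  Hom H K := (G ⧸ H.sub) →[G] (G ⧸ K.sub)
  id H := MulActionHom.id G
  comp f g := MulActionHom.comp g f

end Orb

theorem Orb.free_hom_ext {G : Type u} [Group G] {H K : Orb G} {M : Type*} [AddCommGroup M] [Module ℚ M]
    {φ ψ : (Free.of ℚ H ⟶ Free.of ℚ K) →ₗ[ℚ] M}
    (h : ∀ f : H ⟶ K, φ ((Free.embedding ℚ (Orb G)).map f) =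
      ψ ((Free.embedding ℚ (Orb G)).map f)) : φ = ψ :=
  Finsupp.lhom_ext' (R := ℚ) (M := ℚ) fun f => LinearMap.ext_ring (h f)

/-- `ℚOr(G)`, the category algebra of the free `ℚ`-linear category on the orbit category. -/
abbrev OrbitAlgebra (G : Type u) [Group G] : Type u :=
  CategoryAlgebra (Free.of ℚ : Orb G → Free ℚ (Orb G))

/-! ### The rational Mackey category -/

/-- The objects of the rational Mackey category `Ω_ℚ(G)`: the finite `G`-sets. -/
structure MackeyCategory (G : Type u) [Group G] : Type (u + 1) where
  /-- The underlying set. -/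
  carrier : Type u
  [action : MulAction G carrier]
  [finite : Finite carrier]

namespace MackeyCategory

variable {G : Type u} [Group G]

instance (X : MackeyCategory G) : MulAction G X.carrier := X.action

instance (X : MackeyCategory G) : Finite X.carrier := X.finite

/-- A span `X ← V → Y` of finite `G`-sets. -/
structure Span (X Y : MackeyCategory G) : Type (u + 1) where
  /-- The middle object `V`. -/
  mid : MackeyCategory G
  /-- The left leg `V → X`. -/
  left : mid.carrier →[G] X.carrier
  /-- The right leg `V → Y`. -/
  right : mid.carrier →[G] Y.carrier

namespace Span

variable {X Y Z W : MackeyCategory G}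

/-- Isomorphism of spans: a `G`-equivariant bijection of the middle objects which is compatible
with the legs. -/
def Iso (S T : Span X Y) : Prop :=
  ∃ e : S.mid.carrier ≃ T.mid.carrier, (∀ (g : G) v, e (g • v) = g • e v) ∧
    (∀ v, T.left (e v) = S.left v) ∧ ∀ v, T.right (e v) = S.right v

/-- The disjoint union of two spans. -/
def sum (S T : Span X Y) : Span X Y where
  mid := ⟨S.mid.carrier ⊕ T.mid.carrier⟩
  left :=
    { toFun := Sum.elim S.left T.left
      map_smul' := by rintro g (v | v) <;> simp }
  right :=
    { toFun := Sum.elim S.right T.right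
      map_smul' := by rintro g (v | v) <;> simp }

/-- The identity span `X ← X → X`. -/
def id (X : MackeyCategory G) : Span X X where
  mid := X
  left := MulActionHom.id G
  right := MulActionHom.id G

/-- The underlying set of the pullback `V ×_Y W` of two spans `X ← V → Y` and `Y ← W → Z`. -/
def Pullback (S : Span X Y) (T : Span Y Z) : Type u :=
  {p : S.mid.carrier × T.mid.carrier // S.right p.1 = T.left p.2}

instance (S : Span X Y) (T : Span Y Z) : MulAction G (Pullback S T) where
  smul g p := ⟨(g • p.1.1, g • p.1.2), by simp [p.2]⟩
  one_smul p := Subtype.ext (one_smul G p.1)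
  mul_smul g h p := Subtype.ext (mul_smul g h p.1)

instance (S : Span X Y) (T : Span Y Z) : Finite (Pullback S T) :=
  inferInstanceAs (Finite {p : S.mid.carrier × T.mid.carrier // S.right p.1 = T.left p.2})

/-- The composite `X ← V ×_Y W → Z` of the spans `X ← V → Y` and `Y ← W → Z`. -/
def comp (S : Span X Y) (T : Span Y Z) : Span X Z where
  mid := ⟨Pullback S T⟩
  left :=
    { toFun := fun p => S.left p.1.1
      map_smul' := fun g p => map_smul S.left g p.1.1 }
  right :=
    { toFun := fun p => T.right p.1.2
      map_smul' := fun g p => map_smul T.right g p.1.2 }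

theorem Iso.comp {S S' : Span X Y} {T T' : Span Y Z} (h : Iso S S') (h' : Iso T T') :
    Iso (S.comp T) (S'.comp T') := by
  obtain ⟨e, he, hl, hr⟩ := h
  obtain ⟨e', he', hl', hr'⟩ := h'
  refine ⟨(e.prodCongr e').subtypeEquiv fun p => ?_, fun g p => ?_, fun p => ?_, fun p => ?_⟩
  · simp [hr, hl']
  · exact Subtype.ext (Prod.ext (he g p.1.1) (he' g p.1.2))
  · exact hl p.1.1
  · exact hr' p.1.2

theorem Iso.refl (S : Span X Y) : Iso S S :=
  ⟨Equiv.refl _, fun _ _ => rfl, fun _ => rfl, fun _ => rfl⟩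

theorem id_comp_iso (S : Span X Y) : Iso ((Span.id X).comp S) S :=
  ⟨{ toFun := fun p => p.1.2
     invFun := fun v => ⟨(S.left v, v), rfl⟩
     left_inv := fun p => Subtype.ext (Prod.ext p.2.symm rfl)
     right_inv := fun _ => rfl },
    fun _ _ => rfl, fun p => p.2.symm, fun _ => rfl⟩

theorem comp_id_iso (S : Span X Y) : Iso (S.comp (Span.id Y)) S :=
  ⟨{ toFun := fun p => p.1.1
     invFun := fun v => ⟨(v, S.right v), rfl⟩
     left_inv := fun p => Subtype.ext (Prod.ext rfl p.2)
     right_inv := fun _ => rfl },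
    fun _ _ => rfl, fun _ => rfl, fun p => p.2⟩

theorem assoc_iso (S : Span X Y) (T : Span Y Z) (U : Span Z W) :
    Iso ((S.comp T).comp U) (S.comp (T.comp U)) :=
  ⟨{ toFun := fun p => ⟨(p.1.1.1.1, ⟨(p.1.1.1.2, p.1.2), p.2⟩), p.1.1.2⟩
     invFun := fun p => ⟨(⟨(p.1.1, p.1.2.1.1), p.2⟩, p.1.2.1.2), p.1.2.2⟩
     left_inv := fun _ => rfl
     right_inv := fun _ => rfl },
    fun _ _ => rfl, fun _ => rfl, fun _ => rfl⟩

theorem sum_comp_iso (S S' : Span X Y) (T : Span Y Z) :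
    Iso ((S.sum S').comp T) ((S.comp T).sum (S'.comp T)) :=
  ⟨{ toFun := fun p => match p with
      | ⟨(Sum.inl v, w), h⟩ => Sum.inl ⟨(v, w), h⟩
      | ⟨(Sum.inr v, w), h⟩ => Sum.inr ⟨(v, w), h⟩
     invFun := fun p => match p with
      | Sum.inl q => ⟨(Sum.inl q.1.1, q.1.2), q.2⟩
      | Sum.inr q => ⟨(Sum.inr q.1.1, q.1.2), q.2⟩
     left_inv := by rintro ⟨⟨v | v, w⟩, h⟩ <;> rfl
     right_inv := by rintro (q | q) <;> rfl },
    by rintro g ⟨⟨v | v, w⟩, h⟩ <;> rfl,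
    by rintro ⟨⟨v | v, w⟩, h⟩ <;> rfl,
    by rintro ⟨⟨v | v, w⟩, h⟩ <;> rfl⟩

theorem comp_sum_iso (S : Span X Y) (T T' : Span Y Z) :
    Iso (S.comp (T.sum T')) ((S.comp T).sum (S.comp T')) :=
  ⟨{ toFun := fun p => match p with
      | ⟨(v, Sum.inl w), h⟩ => Sum.inl ⟨(v, w), h⟩
      | ⟨(v, Sum.inr w), h⟩ => Sum.inr ⟨(v, w), h⟩
     invFun := fun p => match p with
      | Sum.inl q => ⟨(q.1.1, Sum.inl q.1.2), q.2⟩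
      | Sum.inr q => ⟨(q.1.1, Sum.inr q.1.2), q.2⟩
     left_inv := by rintro ⟨⟨v, w | w⟩, h⟩ <;> rfl
     right_inv := by rintro (q | q) <;> rfl },
    by rintro g ⟨⟨v, w | w⟩, h⟩ <;> rfl,
    by rintro ⟨⟨v, w | w⟩, h⟩ <;> rfl,
    by rintro ⟨⟨v, w | w⟩, h⟩ <;> rfl⟩

end Span

/-- The relations of the Grothendieck group of spans: `[S] = [T]` for isomorphic spans, and
`[S ⊔ T] = [S] + [T]`. -/
def relations (X Y : MackeyCategory G) : Set (Span X Y →₀ ℚ) :=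
  {x | ∃ S T : Span X Y, S.Iso T ∧ x = Finsupp.single S 1 - Finsupp.single T 1} ∪
  {x | ∃ S T : Span X Y, x =
    Finsupp.single (S.sum T) 1 - (Finsupp.single S 1 + Finsupp.single T 1)}

/-- The morphisms from `X` to `Y` in the Mackey category: the rationalised Grothendieck group of
isomorphism classes of spans `X ← V → Y` under disjoint union, presented as a `ℚ`-vector space by
generators and relations. -/
def MHom (X Y : MackeyCategory G) : Type (u + 1) :=
  (Span X Y →₀ ℚ) ⧸ Submodule.span ℚ (relations X Y)

noncomputable instance (X Y : MackeyCategory G) : AddCommGroup (MHom X Y) :=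
  inferInstanceAs (AddCommGroup ((Span X Y →₀ ℚ) ⧸ Submodule.span ℚ (relations X Y)))

noncomputable instance (X Y : MackeyCategory G) : Module ℚ (MHom X Y) :=
  inferInstanceAs (Module ℚ ((Span X Y →₀ ℚ) ⧸ Submodule.span ℚ (relations X Y)))

section

variable {X Y Z W : MackeyCategory G}

/-- The class of a span. -/
noncomputable def cls (S : Span X Y) : MHom X Y :=
  (Submodule.span ℚ (relations X Y)).mkQ (Finsupp.single S 1)

theorem cls_eq_of_iso {S T : Span X Y} (h : S.Iso T) : cls S = cls T := by
  refine (Submodule.Quotient.eq _).2 (Submodule.subset_span ?_)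
  exact Or.inl ⟨S, T, h, rfl⟩

theorem cls_sum (S T : Span X Y) : cls (S.sum T) = cls S + cls T := by
  refine (Submodule.Quotient.eq _).2 (Submodule.subset_span ?_)
  exact Or.inr ⟨S, T, rfl⟩

/-- The universal property of the space of morphisms. -/
noncomputable def MHom.lift {M : Type*} [AddCommGroup M] [Module ℚ M] (φ : Span X Y → M)
    (hiso : ∀ S T : Span X Y, S.Iso T → φ S = φ T)
    (hsum : ∀ S T : Span X Y, φ (S.sum T) = φ S + φ T) : MHom X Y →ₗ[ℚ] M :=
  (Submodule.span ℚ (relations X Y)).liftQ (Finsupp.linearCombination ℚ φ) <| by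
    rw [Submodule.span_le]
    rintro x (⟨S, T, h, rfl⟩ | ⟨S, T, rfl⟩)
    · simp [hiso S T h]
    · simp [hsum S T]

@[simp] theorem MHom.lift_cls {M : Type*} [AddCommGroup M] [Module ℚ M] (φ : Span X Y → M)
    (hiso : ∀ S T : Span X Y, S.Iso T → φ S = φ T)
    (hsum : ∀ S T : Span X Y, φ (S.sum T) = φ S + φ T) (S : Span X Y) :
    MHom.lift φ hiso hsum (cls S) = φ S := by
  refine (Submodule.liftQ_apply _ _ _).trans ?_
  simp

theorem MHom.hom_ext {M : Type*} [AddCommGroup M] [Module ℚ M] {f g : MHom X Y →ₗ[ℚ] M}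
    (h : ∀ S, f (cls S) = g (cls S)) : f = g := by
  refine Submodule.linearMap_qext _ (Finsupp.lhom_ext' fun S => LinearMap.ext_ring ?_)
  exact h S

/-- Composition of morphisms: the bilinear extension of the composition of spans by pullback. -/
noncomputable def compLin (X Y Z : MackeyCategory G) :
    MHom X Y →ₗ[ℚ] MHom Y Z →ₗ[ℚ] MHom X Z :=
  MHom.lift
    (fun S => MHom.lift (fun T => cls (S.comp T))
      (fun _ _ h => cls_eq_of_iso ((Span.Iso.refl S).comp h))
      (fun T T' => by rw [cls_eq_of_iso (Span.comp_sum_iso S T T'), cls_sum]))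
    (fun S S' h => MHom.hom_ext fun T => by
      simpa using cls_eq_of_iso (h.comp (Span.Iso.refl T)))
    (fun S S' => MHom.hom_ext fun T => by
      simp [cls_eq_of_iso (Span.sum_comp_iso S S' T), cls_sum])

@[simp] theorem compLin_cls (S : Span X Y) (T : Span Y Z) :
    compLin X Y Z (cls S) (cls T) = cls (S.comp T) := by
  simp [compLin]

theorem id_compLin (f : MHom X Y) : compLin X X Y (cls (Span.id X)) f = f := by
  have : compLin X X Y (cls (Span.id X)) = LinearMap.id :=
    MHom.hom_ext fun S => by simpa using cls_eq_of_iso (Span.id_comp_iso S)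
  rw [this, LinearMap.id_apply]

theorem compLin_id (f : MHom X Y) : compLin X Y Y f (cls (Span.id Y)) = f := by
  have : (compLin X Y Y).flip (cls (Span.id Y)) = LinearMap.id :=
    MHom.hom_ext fun S => by simpa using cls_eq_of_iso (Span.comp_id_iso S)
  exact LinearMap.congr_fun this f

theorem compLin_assoc (f : MHom X Y) (g : MHom Y Z) (h : MHom Z W) :
    compLin X Z W (compLin X Y Z f g) h = compLin X Y W f (compLin Y Z W g h) := by
  have h1 : ∀ (T : Span Y Z) (U : Span Z W),
      (compLin X Z W).flip (cls U) ∘ₗ (compLin X Y Z).flip (cls T) =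
        (compLin X Y W).flip (compLin Y Z W (cls T) (cls U)) := fun T U =>
    MHom.hom_ext fun S => by simpa using cls_eq_of_iso (Span.assoc_iso S T U)
  have h2 : ∀ U : Span Z W, (compLin X Z W).flip (cls U) ∘ₗ compLin X Y Z f =
      compLin X Y W f ∘ₗ (compLin Y Z W).flip (cls U) := fun U =>
    MHom.hom_ext fun T => LinearMap.congr_fun (h1 T U) f
  have h3 : compLin X Z W (compLin X Y Z f g) = compLin X Y W f ∘ₗ compLin Y Z W g :=
    MHom.hom_ext fun U => LinearMap.congr_fun (h2 U) g
  exact LinearMap.congr_fun h3 h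

end

noncomputable instance instCategory : Category (MackeyCategory G) where
  Hom X Y := MHom X Y
  id X := cls (Span.id X)
  comp f g := compLin _ _ _ f g
  id_comp f := id_compLin f
  comp_id f := compLin_id f
  assoc f g h := compLin_assoc f g h

noncomputable instance instPreadditive : Preadditive (MackeyCategory G) where
  homGroup X Y := inferInstanceAs (AddCommGroup (MHom X Y))
  add_comp X Y Z f f' g := by
    exact LinearMap.map_add₂ (compLin X Y Z) f f' g
  comp_add X Y Z f g g' := by
    exact LinearMap.map_add (compLin X Y Z f) g g'

noncomputable instance instLinear : Linear ℚ (MackeyCategory G) where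
  homModule X Y := inferInstanceAs (Module ℚ (MHom X Y))
  smul_comp X Y Z r f g := by
    exact LinearMap.map_smul₂ (compLin X Y Z) r f g
  comp_smul X Y Z f r g := by
    exact LinearMap.map_smul (compLin X Y Z f) r g

/-- The transitive `G`-set `G/H` as an object of the Mackey category. -/
def orbit [Finite G] (H : Orb G) : MackeyCategory G := ⟨G ⧸ H.sub⟩

/-- The span `X ← X → Y`, with left leg the identity, given by an equivariant map `f : X → Y`. -/
def Span.graph {X Y : MackeyCategory G} (f : X.carrier →[G] Y.carrier) : Span X Y where
  mid := X
  left := MulActionHom.id G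
  right := f

theorem Span.graph_comp_iso {X Y Z : MackeyCategory G} (f : X.carrier →[G] Y.carrier)
    (g : Y.carrier →[G] Z.carrier) :
    Iso ((Span.graph f).comp (Span.graph g)) (Span.graph (g.comp f)) :=
  ⟨{ toFun := fun p => p.1.1
     invFun := fun x => ⟨(x, f x), rfl⟩
     left_inv := fun p => Subtype.ext (Prod.ext rfl p.2)
     right_inv := fun _ => rfl },
    fun _ _ => rfl, fun _ => rfl, fun p => congrArg g p.2⟩

end MackeyCategory

/-! ### The Mackey algebra as a left module over `ℚOr(G)` -/

/-- The rational Mackey algebra `μ_ℚ(G)`: the category algebra of the Mackey category on the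
objects `G/H`, one for every subgroup `H` of `G`. -/
abbrev MackeyAlgebra (G : Type u) [Group G] [Finite G] : Type (u + 1) :=
  CategoryAlgebra (MackeyCategory.orbit : Orb G → MackeyCategory G)

/-- The canonical functor `Or(G) ⥤ Ω_ℚ(G)`. It is the identity on objects and sends an
equivariant map `f : G/H → G/K` to the class of the span `G/H ← G/H → G/K` with legs `id` and `f`.
For `f(xH) = xg⁻¹K` with `gHg⁻¹ ≤ K` this is conjugation by `g` from `H` to `gHg⁻¹` followed by
induction from `gHg⁻¹` to `K`. -/
noncomputable def orbitFunctor (G : Type u) [Group G] [Finite G] : Orb G ⥤ MackeyCategory G where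
  obj H := MackeyCategory.orbit H
  map {H K} f := MackeyCategory.cls (MackeyCategory.Span.graph (X := MackeyCategory.orbit H)
      (Y := MackeyCategory.orbit K) f)
  map_id _ := rfl
  map_comp {H K L} f g :=
    ((MackeyCategory.compLin_cls _ _).trans (MackeyCategory.cls_eq_of_iso
      (MackeyCategory.Span.graph_comp_iso (X := MackeyCategory.orbit H)
        (Y := MackeyCategory.orbit K) (Z := MackeyCategory.orbit L) f g))).symm

/-- The `ℚ`-linear extension of the canonical functor `Or(G) ⥤ Ω_ℚ(G)` on the space of morphisms
from `G/H` to `G/K`. -/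
noncomputable def orbitLinear {G : Type u} [Group G] [Finite G] (H K : Orb G) :
    (Free.of ℚ H ⟶ Free.of ℚ K) →ₗ[ℚ] (MackeyCategory.orbit H ⟶ MackeyCategory.orbit K) :=
  Finsupp.linearCombination ℚ fun f : H ⟶ K => (orbitFunctor G).map f

section

variable {G : Type u} [Group G] [Finite G] {H K L : Orb G}

theorem orbitLinear_map (f : H ⟶ K) :
    orbitLinear H K ((Free.embedding ℚ (Orb G)).map f) = (orbitFunctor G).map f :=
  (Finsupp.linearCombination_single ℚ 1 f).trans (one_smul ℚ _)

theorem orbitLinear_comp (f : Free.of ℚ H ⟶ Free.of ℚ K) (g : Free.of ℚ K ⟶ Free.of ℚ L) :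
    orbitLinear H L (f ≫ g) = orbitLinear H K f ≫ orbitLinear K L g := by
  have h1 : ∀ f : H ⟶ K,
      orbitLinear H L ∘ₗ
          Linear.leftComp ℚ (Free.of ℚ L) ((Free.embedding ℚ (Orb G)).map f) =
        Linear.leftComp ℚ (MackeyCategory.orbit L) ((orbitFunctor G).map f) ∘ₗ
          orbitLinear K L := fun f => by
    refine Orb.free_hom_ext fun g => ?_
    refine (congrArg (orbitLinear H L)
      ((Free.embedding ℚ (Orb G)).map_comp f g).symm).trans ?_
    refine (orbitLinear_map (f ≫ g)).trans ?_
    refine ((orbitFunctor G).map_comp f g).trans ?_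
    exact congrArg (fun t => (orbitFunctor G).map f ≫ t) (orbitLinear_map g).symm
  have h2 : orbitLinear H L ∘ₗ Linear.rightComp ℚ (Free.of ℚ H) g =
      Linear.rightComp ℚ (MackeyCategory.orbit H) (orbitLinear K L g) ∘ₗ
        orbitLinear H K := by
    refine Orb.free_hom_ext fun f => ?_
    refine (LinearMap.congr_fun (h1 f) g).trans ?_
    exact congrArg (fun t => t ≫ orbitLinear K L g) (orbitLinear_map f).symm
  exact LinearMap.congr_fun h2 f

end

/-- The ring homomorphism `ℚOr(G) → μ_ℚ(G)` given by the `ℚ`-linear extension of the canonical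
functor `Or(G) ⥤ Ω_ℚ(G)`. -/
noncomputable def orbitToMackey (G : Type u) [Group G] [Finite G] :
    OrbitAlgebra G →+* MackeyAlgebra G where
  toFun a := fun H K => orbitLinear H K (a H K)
  map_one' := by
    refine CategoryAlgebra.ext fun H K => ?_
    by_cases h : H = K
    · subst h
      rw [CategoryAlgebra.one_apply_self, CategoryAlgebra.one_apply_self]
      exact (orbitLinear_map (𝟙 H)).trans ((orbitFunctor G).map_id H)
    · rw [CategoryAlgebra.one_apply_ne h, CategoryAlgebra.one_apply_ne h, map_zero]
  map_mul' a b := by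
    refine CategoryAlgebra.ext fun H K => ?_
    refine (map_sum (orbitLinear H K) _ _).trans ?_
    exact Finset.sum_congr rfl fun L _ => orbitLinear_comp (b H L) (a L K)
  map_zero' := CategoryAlgebra.ext fun H K => map_zero (orbitLinear H K)
  map_add' a b := CategoryAlgebra.ext fun H K => map_add (orbitLinear H K) (a H K) (b H K)

/-- `μ_ℚ(G)` as a left `ℚOr(G)`-module: `a • m` is the product of the image of `a` in `μ_ℚ(G)`
with `m`. -/
noncomputable instance MackeyAlgebra.instModule (G : Type u) [Group G] [Finite G] :
    Module (OrbitAlgebra G) (MackeyAlgebra G) :=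
  Module.compHom (MackeyAlgebra G) (orbitToMackey G)

/-!
Fix `H`. The morphisms of `Or(G)` act on the spans `G/H ← V → G/K` through the right leg only, so
`K ↦ Hom(G/H, G/K)` is the direct sum, over the transitive `G`-sets `G/L` over `G/H` up to
isomorphism, of the coinvariants of the representable functor `ℚ Hom(G/L, -)` under the finite group
of automorphisms of `G/L` over `G/H`. The order of this group is invertible in `ℚ`, so averaging
makes the coinvariants a direct summand of the representable functor, which is projective.

The proof carries out the averaging without choosing representatives of the isomorphism classes.
`mackeySection` sends the class of a span `G/H ← V → G/K` to the sum over all points `v` of `V`, with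
stabilizer `G_v`, of `|G_v| / |G|` times the map `G/G_v → G/K` through the image of `v`, as a
coefficient of the basis vector for the span `G/H ← G/G_v → G/G_v` with right leg the identity. This
depends only on the isomorphism class of the span, it is additive in `V`, and it is linear over
`ℚOr(G)` because a morphism of `Or(G)` changes only the coefficients (`sectionAddHom_smul`). It is a
section of the surjection from the free module because the terms of the points of an orbit all map
to the class of that orbit, and their weights add up to `1` (`stabSum_ofPoints`).
-/

open MackeyCategory

/-! ### Elementary matrices in a category algebra -/

namespace CategoryAlgebra

variable {ι D : Type*} [Category D] {obj : ι → D} [Preadditive D]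

open Classical in
/-- The element of the category algebra whose only nonzero component is `f`, at `(i, j)`. -/
noncomputable def single (obj : ι → D) (i j : ι) : (obj i ⟶ obj j) →+ CategoryAlgebra obj where
  toFun f := Pi.single (M := fun i => ∀ j, obj i ⟶ obj j) i (Pi.single j f)
  map_zero' := by
    rw [Pi.single_zero]
    exact Pi.single_zero (M := fun i => ∀ j, obj i ⟶ obj j) i
  map_add' f g := by
    rw [Pi.single_add]
    exact Pi.single_add (f := fun i => ∀ j, obj i ⟶ obj j) i _ _

open Classical in
theorem single_apply (i j : ι) (f : obj i ⟶ obj j) (i' j' : ι) : single obj i j f i' j' =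
    Pi.single (M := fun i => ∀ j, obj i ⟶ obj j) i (Pi.single j f) i' j' := rfl

theorem single_apply_self (i j : ι) (f : obj i ⟶ obj j) : single obj i j f i j = f := by
  simp [single_apply]

theorem single_apply_of_ne_left {i i' : ι} (h : i' ≠ i) (j j' : ι) (f : obj i ⟶ obj j) :
    single obj i j f i' j' = 0 := by
  simp [single_apply, h]

theorem single_apply_of_ne_right (i i' : ι) {j j' : ι} (h : j' ≠ j) (f : obj i ⟶ obj j) :
    single obj i j f i' j' = 0 := by
  by_cases hi : i' = i
  · subst hi
    simp [single_apply, h]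
  · exact single_apply_of_ne_left hi j j' f

variable [Fintype ι]

theorem single_mul_single {i j k : ι} (g : obj j ⟶ obj k) (f : obj i ⟶ obj j) :
    single obj j k g * single obj i j f = single obj i k (f ≫ g) := by
  ext x y
  rw [mul_apply, Finset.sum_eq_single j]
  · by_cases hx : x = i
    · subst hx
      by_cases hy : y = k
      · subst hy
        simp only [single_apply_self]
      · simp [single_apply_of_ne_right _ _ hy]
    · simp [single_apply_of_ne_left hx]
  · intro z _ hz
    simp [single_apply_of_ne_left hz]
  · simp

theorem single_mul_single_of_ne {i j j' k : ι} (h : j ≠ j') (g : obj j' ⟶ obj k)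
    (f : obj i ⟶ obj j) : single obj j' k g * single obj i j f = 0 := by
  ext x y
  rw [mul_apply, zero_apply]
  refine Finset.sum_eq_zero fun z _ => ?_
  by_cases hz : z = j
  · subst hz
    simp [single_apply_of_ne_left h]
  · simp [single_apply_of_ne_right _ _ hz]

theorem sum_single (a : CategoryAlgebra obj) : ∑ i, ∑ j, single obj i j (a i j) = a := by
  classical
  refine Eq.trans ?_ (Finset.univ_sum_single (M := fun i => ∀ j, obj i ⟶ obj j) a)
  refine Finset.sum_congr rfl fun i _ => ?_
  conv_rhs => rw [← Finset.univ_sum_single (a i)]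
  refine Eq.trans ?_ (map_sum
    (AddMonoidHom.single (fun i => ∀ j, obj i ⟶ obj j) i) _ _).symm
  refine Finset.sum_congr rfl fun j _ => ?_
  simp only [single]
  congr!

/-- Additive maps out of a category algebra are determined by their values on elementary
matrices. -/
theorem addHom_ext {M : Type*} [AddCommMonoid M] {φ ψ : CategoryAlgebra obj →+ M}
    (h : ∀ i j f, φ (single obj i j f) = ψ (single obj i j f)) : φ = ψ := by
  ext a
  rw [← sum_single a]
  simp only [map_sum, h]

end CategoryAlgebra

namespace MackeyCategory

variable {G : Type u} [Group G]

/-! ### Decomposition of a span into orbits -/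

/-- The equivariant map `G/N → X`, `gN ↦ g • x`, for a point `x` which is fixed by `N`. -/
def quotientMap {X : Type*} [MulAction G X] (N : Subgroup G) (x : X)
    (h : N ≤ MulAction.stabilizer G x) : (G ⧸ N) →[G] X where
  toFun q := Quotient.liftOn' q (fun g => g • x) fun a b hab => by
    have := h (QuotientGroup.leftRel_apply.mp hab)
    rw [MulAction.mem_stabilizer_iff, mul_smul, inv_smul_eq_iff] at this
    exact this.symm
  map_smul' g q := by
    induction q using Quotient.inductionOn' with
    | h a => exact mul_smul g a x

theorem comp_quotientMap {X Y : Type*} [MulAction G X] [MulAction G Y] (f : X →[G] Y)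
    (N : Subgroup G) (x : X) (h : N ≤ MulAction.stabilizer G x)
    (h' : N ≤ MulAction.stabilizer G (f x)) :
    f.comp (quotientMap N x h) = quotientMap N (f x) h' := by
  ext q
  induction q using Quotient.inductionOn' with
  | h a => exact map_smul f a x

theorem stabilizer_le_map {X Y : Type*} [MulAction G X] [MulAction G Y] (f : X →[G] Y) (x : X) :
    MulAction.stabilizer G x ≤ MulAction.stabilizer G (f x) := fun g hg => by
  rw [MulAction.mem_stabilizer_iff] at hg ⊢
  rw [← map_smul, hg]

variable {X Y Z : MackeyCategory G}

/-- The sum of `t G_v x y` over the points `v` of a span `X ← V → Y`, where `G_v` is the stabilizer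
of `v`, and `x` and `y` are the images of `v` in `X` and `Y`. -/
noncomputable def Span.stabSum {M : Type*} [AddCommGroup M]
    (t : ∀ (N : Subgroup G) (x : X.carrier) (y : Y.carrier), N ≤ MulAction.stabilizer G x →
      N ≤ MulAction.stabilizer G y → M) (S : Span X Y) : M :=
  letI := Fintype.ofFinite S.mid.carrier
  ∑ v : S.mid.carrier, t (MulAction.stabilizer G v) (S.left v) (S.right v)
    (stabilizer_le_map S.left v) (stabilizer_le_map S.right v)

section

variable {M : Type*} [AddCommGroup M]
    (t : ∀ (N : Subgroup G) (x : X.carrier) (y : Y.carrier), N ≤ MulAction.stabilizer G x →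
      N ≤ MulAction.stabilizer G y → M)

theorem Span.stabSum_eq_of_iso {S T : Span X Y} (h : S.Iso T) : S.stabSum t = T.stabSum t := by
  obtain ⟨e, he, hl, hr⟩ := h
  let _ := Fintype.ofFinite S.mid.carrier
  let _ := Fintype.ofFinite T.mid.carrier
  refine Fintype.sum_equiv e _ _ fun v => ?_
  have hs : MulAction.stabilizer G v = MulAction.stabilizer G (e v) := by
    ext g
    rw [MulAction.mem_stabilizer_iff, MulAction.mem_stabilizer_iff, ← he, e.injective.eq_iff]
  congr 1
  · exact (hl v).symm
  · exact (hr v).symm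

theorem Span.stabSum_sum (S T : Span X Y) :
    (S.sum T).stabSum t = S.stabSum t + T.stabSum t := by
  let _ := Fintype.ofFinite S.mid.carrier
  let _ := Fintype.ofFinite T.mid.carrier
  have hl : ∀ v : S.mid.carrier, MulAction.stabilizer G (Sum.inl v : S.mid.carrier ⊕ T.mid.carrier)
      = MulAction.stabilizer G v := fun v => by
    ext g
    simp [MulAction.mem_stabilizer_iff]
  have hr : ∀ v : T.mid.carrier, MulAction.stabilizer G (Sum.inr v : S.mid.carrier ⊕ T.mid.carrier)
      = MulAction.stabilizer G v := fun v => by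
    ext g
    simp [MulAction.mem_stabilizer_iff]
  refine Eq.trans ?_ ((Fintype.sum_sum_type fun v : S.mid.carrier ⊕ T.mid.carrier =>
    t (MulAction.stabilizer G v) ((S.sum T).left v) ((S.sum T).right v)
      (stabilizer_le_map (S.sum T).left v) (stabilizer_le_map (S.sum T).right v)).trans
    (congrArg₂ (· + ·) ?_ ?_))
  · let _ := Fintype.ofFinite (S.sum T).mid.carrier
    exact Fintype.sum_equiv (ι := (S.sum T).mid.carrier) (κ := S.mid.carrier ⊕ T.mid.carrier)
      (Equiv.refl _) _ _ fun _ => rfl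
  · refine Finset.sum_congr rfl fun v _ => ?_
    congr 1
    exact hl v
  · refine Finset.sum_congr rfl fun v _ => ?_
    congr 1
    exact hr v

end

/-- The span `X ← G/N → Y` through the images `x` and `y` of the trivial coset. -/
def Span.ofPoints [Finite G] (N : Subgroup G) (x : X.carrier) (y : Y.carrier)
    (hx : N ≤ MulAction.stabilizer G x) (hy : N ≤ MulAction.stabilizer G y) : Span X Y where
  mid := orbit ⟨N⟩
  left := quotientMap N x hx
  right := quotientMap N y hy

/-- The restriction of a span `X ← V → Y` to a `G`-stable subset of `V`. -/
def Span.restrict (S : Span X Y) (A : SubMulAction G S.mid.carrier) : Span X Y where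
  mid := ⟨A⟩
  left := S.left.comp A.subtype
  right := S.right.comp A.subtype

theorem Span.sum_restrict_iso (S : Span X Y) (A B : SubMulAction G S.mid.carrier)
    (h : ∀ v, v ∈ B ↔ v ∉ A) : ((S.restrict A).sum (S.restrict B)).Iso S := by
  classical
  refine ⟨((Equiv.refl _).sumCongr (Equiv.subtypeEquivRight h)).trans
    (Equiv.sumCompl fun v => v ∈ A), ?_, ?_, ?_⟩
  · rintro g (v | v) <;> rfl
  · rintro (v | v) <;> rfl
  · rintro (v | v) <;> rfl

theorem Span.ofPoints_iso [Finite G] (S : Span X Y) [MulAction.IsPretransitive G S.mid.carrier]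
    (v : S.mid.carrier) :
    (Span.ofPoints (MulAction.stabilizer G v) (S.left v) (S.right v)
      (stabilizer_le_map S.left v) (stabilizer_le_map S.right v)).Iso S := by
  refine ⟨Equiv.ofBijective (quotientMap (MulAction.stabilizer G v) v le_rfl) ⟨?_, ?_⟩,
    ?_, ?_, ?_⟩
  · exact MulAction.injective_ofQuotientStabilizer G v
  · intro w
    obtain ⟨g, rfl⟩ := MulAction.exists_smul_eq G v w
    exact ⟨(g : G ⧸ MulAction.stabilizer G v), rfl⟩
  · exact fun g q => map_smul (quotientMap (MulAction.stabilizer G v) v le_rfl) g q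
  · exact fun q => DFunLike.congr_fun
      (comp_quotientMap S.left _ v le_rfl (stabilizer_le_map S.left v)) q
  · exact fun q => DFunLike.congr_fun
      (comp_quotientMap S.right _ v le_rfl (stabilizer_le_map S.right v)) q

/-- An empty span is isomorphic to the disjoint union of two copies of itself. -/
theorem cls_eq_zero_of_isEmpty (S : Span X Y) [IsEmpty S.mid.carrier] : cls S = 0 := by
  have h : (S.sum S).Iso S :=
    ⟨Equiv.sumEmpty S.mid.carrier S.mid.carrier, by rintro g (v | v) <;> exact isEmptyElim v,
      by rintro (v | v) <;> exact isEmptyElim v, by rintro (v | v) <;> exact isEmptyElim v⟩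
  have := (cls_sum S S).symm.trans (cls_eq_of_iso h)
  simpa using this

/-- The weight `|N| / |G| = 1 / |G/N|`; the weights of the points of an orbit add up to `1`. -/
noncomputable def weight (N : Subgroup G) : ℚ := Nat.card N / Nat.card G

theorem stabSum_ofPoints_of_transitive [Finite G] (S : Span X Y)
    [MulAction.IsPretransitive G S.mid.carrier] [Nonempty S.mid.carrier] :
    S.stabSum (fun N x y hx hy => weight N • cls (Span.ofPoints N x y hx hy)) = cls S := by
  let _ := Fintype.ofFinite S.mid.carrier
  have hw : ∀ v : S.mid.carrier, weight (MulAction.stabilizer G v) •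
      cls (Span.ofPoints (MulAction.stabilizer G v) (S.left v) (S.right v)
        (stabilizer_le_map S.left v) (stabilizer_le_map S.right v)) =
      (Fintype.card S.mid.carrier : ℚ)⁻¹ • cls S := fun v => by
    rw [cls_eq_of_iso (S.ofPoints_iso v)]
    congr 1
    have h1 := MulAction.index_stabilizer_of_transitive G v
    have h2 := (MulAction.stabilizer G v).card_mul_index
    rw [h1] at h2
    have h3 : (Nat.card (MulAction.stabilizer G v) : ℚ) ≠ 0 := by
      exact_mod_cast Nat.card_pos.ne'
    have h4 : (Fintype.card S.mid.carrier : ℚ) ≠ 0 := by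
      exact_mod_cast Fintype.card_ne_zero
    rw [weight, ← h2, Nat.card_eq_fintype_card (α := S.mid.carrier)]
    push_cast
    field_simp
  refine (Finset.sum_congr rfl fun v _ => hw v).trans ?_
  rw [Finset.sum_const, Finset.card_univ, ← Nat.cast_smul_eq_nsmul ℚ, smul_smul,
    mul_inv_cancel₀ (by exact_mod_cast Fintype.card_ne_zero), one_smul]

/-- A span is the weighted sum over its points of the spans through the orbits of these points. -/
theorem stabSum_ofPoints [Finite G] (S : Span X Y) :
    S.stabSum (fun N x y hx hy => weight N • cls (Span.ofPoints N x y hx hy)) = cls S := by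
  induction hn : Nat.card S.mid.carrier using Nat.strong_induction_on generalizing S with
  | _ n ih =>
    subst hn
    rcases isEmpty_or_nonempty S.mid.carrier with hS | ⟨⟨v⟩⟩
    · rw [cls_eq_zero_of_isEmpty S]
      exact Finset.sum_eq_zero fun v _ => isEmptyElim v
    -- Split off the orbit of a point `v`; its complement is smaller.
    · let A : SubMulAction G S.mid.carrier :=
        ⟨MulAction.orbit G v, fun g _ hw => MulAction.mem_orbit_of_mem_orbit g hw⟩
      let B : SubMulAction G S.mid.carrier :=
        ⟨(MulAction.orbit G v)ᶜ, fun g w hw h => hw <| by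
          simpa using MulAction.mem_orbit_of_mem_orbit g⁻¹ h⟩
      have hAB := S.sum_restrict_iso A B fun _ => Iff.rfl
      have : MulAction.IsPretransitive G (S.restrict A).mid.carrier :=
        inferInstanceAs (MulAction.IsPretransitive G (MulAction.orbit G v))
      have : Nonempty (S.restrict A).mid.carrier := ⟨⟨v, MulAction.mem_orbit_self v⟩⟩
      have hB : Nat.card (S.restrict B).mid.carrier < Nat.card S.mid.carrier :=
        Finite.card_subtype_lt (p := fun w => w ∈ B) (x := v)
          fun h => h (MulAction.mem_orbit_self v)
      rw [← cls_eq_of_iso hAB, ← Span.stabSum_eq_of_iso _ hAB, Span.stabSum_sum, cls_sum,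
        stabSum_ofPoints_of_transitive, ih _ hB _ rfl]

/-- The composite of a span with the graph of `f` is the span with `f` applied to the right leg. -/
theorem Span.comp_graph_iso (S : Span X Y) (f : Y.carrier →[G] Z.carrier) :
    (S.comp (Span.graph f)).Iso ⟨S.mid, S.left, f.comp S.right⟩ :=
  ⟨{ toFun := fun p => p.1.1
     invFun := fun v => ⟨(v, S.right v), rfl⟩
     left_inv := fun p => Subtype.ext (Prod.ext rfl p.2)
     right_inv := fun _ => rfl },
    fun _ _ => rfl, fun _ => rfl, fun p => congrArg f p.2⟩

end MackeyCategory

/-! ### The section of the free cover of the Mackey algebra -/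

theorem smul_rat_smul {R M : Type*} [Ring R] [AddCommGroup M] [Module R M] [Module ℚ M] (a : R)
    (q : ℚ) (m : M) : a • q • m = q • a • m :=
  map_rat_smul (DistribSMul.toAddMonoidHom M a) q m

section

variable {G : Type u} [Group G]

/-- The equivariant map `quotientMap N y hy : G/N → G/K` as a morphism of the orbit category. -/
def orbHom (K : Orb G) (N : Subgroup G) (y : G ⧸ K.sub) (hy : N ≤ MulAction.stabilizer G y) :
    (⟨N⟩ : Orb G) ⟶ K :=
  quotientMap N y hy

theorem orbHom_comp {K L : Orb G} (N : Subgroup G) (y : G ⧸ K.sub)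
    (hy : N ≤ MulAction.stabilizer G y) (f : (G ⧸ K.sub) →[G] (G ⧸ L.sub)) :
    orbHom K N y hy ≫ (show K ⟶ L from f) =
      orbHom L N (f y) (hy.trans (stabilizer_le_map f y)) :=
  comp_quotientMap f N y hy _

end

section

variable {G : Type u} [Group G] [Finite G]

/-- The class of the span `G/H ← G/N → G/N` with right leg the identity and left leg
`gN ↦ g • x`, as an element of the Mackey algebra. These elements are the images of the basis
vectors which occur in the section `mackeySection`. -/
noncomputable def mackeyGenerator (H : Orb G) (N : Subgroup G) (x : G ⧸ H.sub)
    (hx : N ≤ MulAction.stabilizer G x) : MackeyAlgebra G :=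
  CategoryAlgebra.single MackeyCategory.orbit H ⟨N⟩
    (cls (X := MackeyCategory.orbit H) (Y := MackeyCategory.orbit ⟨N⟩)
      ⟨MackeyCategory.orbit ⟨N⟩, quotientMap N x hx, MulActionHom.id G⟩)

/-- The morphism `f` of the orbit category as an element of the orbit algebra. -/
noncomputable def orbitSingle {H K : Orb G} (f : H ⟶ K) : OrbitAlgebra G :=
  CategoryAlgebra.single (Free.of ℚ) H K ((Free.embedding ℚ (Orb G)).map f)

/-- The image of a morphism of the orbit category in the Mackey category. -/
noncomputable def mackeyMap {H K : Orb G} (f : H ⟶ K) :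
    MackeyCategory.orbit H ⟶ MackeyCategory.orbit K :=
  (orbitFunctor G).map f

theorem orbitSingle_mul {H K L : Orb G} (g : K ⟶ L) (f : H ⟶ K) :
    orbitSingle g * orbitSingle f = orbitSingle (f ≫ g) := by
  refine (CategoryAlgebra.single_mul_single (obj := (Free.of ℚ : Orb G → Free ℚ (Orb G))) _ _).trans
    ?_
  rw [orbitSingle, Functor.map_comp]
  rfl

theorem orbitSingle_mul_of_ne {H K K' L : Orb G} (h : K ≠ K') (g : K' ⟶ L) (f : H ⟶ K) :
    orbitSingle g * orbitSingle f = 0 :=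
  CategoryAlgebra.single_mul_single_of_ne h _ _

theorem orbitToMackey_single {H K : Orb G} (f : Free.of ℚ H ⟶ Free.of ℚ K) :
    orbitToMackey G (CategoryAlgebra.single (Free.of ℚ) H K f) =
      CategoryAlgebra.single MackeyCategory.orbit H K (orbitLinear H K f) := by
  refine CategoryAlgebra.ext fun H' K' => ?_
  change orbitLinear H' K' _ = _
  by_cases hH : H' = H
  · subst hH
    by_cases hK : K' = K
    · subst hK
      rw [CategoryAlgebra.single_apply_self, CategoryAlgebra.single_apply_self]
    · rw [CategoryAlgebra.single_apply_of_ne_right _ _ hK,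
        CategoryAlgebra.single_apply_of_ne_right _ _ hK, map_zero]
  · rw [CategoryAlgebra.single_apply_of_ne_left hH,
      CategoryAlgebra.single_apply_of_ne_left hH, map_zero]

theorem orbitToMackey_orbitSingle {H K : Orb G} (f : H ⟶ K) :
    orbitToMackey G (orbitSingle f) =
      CategoryAlgebra.single MackeyCategory.orbit H K (mackeyMap f) := by
  refine (orbitToMackey_single _).trans ?_
  rw [orbitLinear_map, mackeyMap]

theorem MackeyAlgebra.smul_def (a : OrbitAlgebra G) (m : MackeyAlgebra G) :
    a • m = orbitToMackey G a * m :=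
  rfl

/-- The span `G/H ← G/N → G/K` factors as a generator followed by a morphism of `Or(G)`. -/
theorem orbitSingle_smul_mackeyGenerator (H K : Orb G) (N : Subgroup G) (x : G ⧸ H.sub)
    (y : G ⧸ K.sub) (hx : N ≤ MulAction.stabilizer G x) (hy : N ≤ MulAction.stabilizer G y) :
    orbitSingle (orbHom K N y hy) • mackeyGenerator H N x hx =
      CategoryAlgebra.single MackeyCategory.orbit H K
        (cls (Span.ofPoints (X := MackeyCategory.orbit H) (Y := MackeyCategory.orbit K)
          N x y hx hy)) := by
  rw [MackeyAlgebra.smul_def, orbitToMackey_orbitSingle, mackeyGenerator,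
    CategoryAlgebra.single_mul_single]
  congr 1
  exact (compLin_cls _ _).trans (cls_eq_of_iso (Span.comp_graph_iso (X := MackeyCategory.orbit H)
    (Y := MackeyCategory.orbit ⟨N⟩) (Z := MackeyCategory.orbit K) _ _))

/-- The contribution of a point with stabilizer `N` and images `x` and `y` to the section. -/
noncomputable def sectionTerm (H K : Orb G) (N : Subgroup G) (x : G ⧸ H.sub) (y : G ⧸ K.sub)
    (hx : N ≤ MulAction.stabilizer G x) (hy : N ≤ MulAction.stabilizer G y) :
    MackeyAlgebra G →₀ OrbitAlgebra G :=
  weight N • Finsupp.single (mackeyGenerator H N x hx) (orbitSingle (orbHom K N y hy))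

/-- The component at `(H, K)` of the section. -/
noncomputable def sectionComponent (H K : Orb G) :
    MHom (MackeyCategory.orbit H) (MackeyCategory.orbit K) →ₗ[ℚ]
      (MackeyAlgebra G →₀ OrbitAlgebra G) :=
  MHom.lift (Span.stabSum (sectionTerm H K)) (fun _ _ h => Span.stabSum_eq_of_iso _ h)
    (Span.stabSum_sum _)

theorem sectionComponent_cls {H K : Orb G}
    (S : Span (MackeyCategory.orbit H) (MackeyCategory.orbit K)) :
    sectionComponent H K (cls S) = S.stabSum (sectionTerm H K) :=
  MHom.lift_cls _ _ _ S

theorem linearCombination_sectionTerm (H K : Orb G) (N : Subgroup G) (x : G ⧸ H.sub)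
    (y : G ⧸ K.sub) (hx : N ≤ MulAction.stabilizer G x) (hy : N ≤ MulAction.stabilizer G y) :
    Finsupp.linearCombination (OrbitAlgebra G) id (sectionTerm H K N x y hx hy) =
      CategoryAlgebra.single MackeyCategory.orbit H K
        (weight N • cls (Span.ofPoints (X := MackeyCategory.orbit H) (Y := MackeyCategory.orbit K)
          N x y hx hy)) := by
  refine Eq.trans ?_ (map_rat_smul (CategoryAlgebra.single MackeyCategory.orbit H K) _ _).symm
  rw [sectionTerm, map_rat_smul, Finsupp.linearCombination_single, id,
    orbitSingle_smul_mackeyGenerator]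

/-- The sum of all the components of the section, as an additive map. -/
noncomputable def sectionAddHom (G : Type u) [Group G] [Finite G] :
    MackeyAlgebra G →+ (MackeyAlgebra G →₀ OrbitAlgebra G) where
  toFun m := ∑ H, ∑ K, sectionComponent H K (m H K)
  map_zero' := Finset.sum_eq_zero fun H _ => Finset.sum_eq_zero fun K _ =>
    map_zero (sectionComponent H K)
  map_add' m m' := by
    simp only [← Finset.sum_add_distrib]
    exact Finset.sum_congr rfl fun H _ => Finset.sum_congr rfl fun K _ =>
      map_add (sectionComponent H K) (m H K) (m' H K)

theorem sectionAddHom_single (H K : Orb G)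
    (y : MackeyCategory.orbit H ⟶ MackeyCategory.orbit K) :
    sectionAddHom G (CategoryAlgebra.single MackeyCategory.orbit H K y) =
      sectionComponent H K y := by
  change ∑ H', ∑ K', sectionComponent H' K' _ = _
  rw [Finset.sum_eq_single H, Finset.sum_eq_single K]
  · rw [CategoryAlgebra.single_apply_self]
  · intro K' _ hK
    rw [CategoryAlgebra.single_apply_of_ne_right _ _ hK]
    exact map_zero _
  · simp
  · intro H' _ hH
    refine Finset.sum_eq_zero fun K' _ => ?_
    rw [CategoryAlgebra.single_apply_of_ne_left hH]
    exact map_zero _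
  · simp

theorem orbitSingle_smul_sectionTerm {H K L : Orb G} (f : (G ⧸ K.sub) →[G] (G ⧸ L.sub))
    (N : Subgroup G) (x : G ⧸ H.sub) (y : G ⧸ K.sub) (hx : N ≤ MulAction.stabilizer G x)
    (hy : N ≤ MulAction.stabilizer G y) :
    orbitSingle (show K ⟶ L from f) • sectionTerm H K N x y hx hy =
      sectionTerm H L N x (f y) hx (hy.trans (stabilizer_le_map f y)) := by
  rw [sectionTerm, smul_rat_smul, Finsupp.smul_single, smul_eq_mul, orbitSingle_mul, orbHom_comp]
  rfl

theorem orbitSingle_smul_sectionTerm_of_ne {H K K' L : Orb G} (h : K ≠ K') (f : K' ⟶ L)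
    (N : Subgroup G) (x : G ⧸ H.sub) (y : G ⧸ K.sub) (hx : N ≤ MulAction.stabilizer G x)
    (hy : N ≤ MulAction.stabilizer G y) :
    orbitSingle f • sectionTerm H K N x y hx hy = 0 := by
  rw [sectionTerm, smul_rat_smul, Finsupp.smul_single, smul_eq_mul,
    orbitSingle_mul_of_ne h, Finsupp.single_zero, smul_zero]

/-- A morphism of `Or(G)` changes the right leg of a span, but neither the stabilizers nor the left
leg, so that it acts on the coefficients of the section only. -/
theorem sectionComponent_comp {H K L : Orb G} (f : K ⟶ L)
    (y : MackeyCategory.orbit H ⟶ MackeyCategory.orbit K) :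
    sectionComponent H L (y ≫ mackeyMap f) =
      orbitSingle f • sectionComponent H K y := by
  have : sectionComponent H L ∘ₗ (compLin _ _ _).flip (mackeyMap f) =
      (DistribSMul.toAddMonoidHom _ (orbitSingle f)).toRatLinearMap ∘ₗ sectionComponent H K := by
    refine MHom.hom_ext fun S => ?_
    have hS : compLin _ _ _ (cls S) (mackeyMap f) =
        cls (⟨S.mid, S.left, MulActionHom.comp f S.right⟩ :
          Span (MackeyCategory.orbit H) (MackeyCategory.orbit L)) :=
      (compLin_cls _ _).trans (cls_eq_of_iso (Span.comp_graph_iso (Y := MackeyCategory.orbit K)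
        (Z := MackeyCategory.orbit L) S f))
    refine (congrArg (sectionComponent H L) hS).trans ?_
    refine (sectionComponent_cls _).trans ?_
    refine Eq.trans ?_ (congrArg (orbitSingle f • ·) (sectionComponent_cls S)).symm
    refine Eq.trans ?_ (Finset.smul_sum (r := orbitSingle f)).symm
    exact Finset.sum_congr rfl fun v _ => (orbitSingle_smul_sectionTerm f
      (MulAction.stabilizer G v) (S.left v) (S.right v) (stabilizer_le_map S.left v)
      (stabilizer_le_map S.right v)).symm
  exact LinearMap.congr_fun this y

theorem orbitSingle_smul_sectionComponent_of_ne {H K K' L : Orb G} (h : K ≠ K') (f : K' ⟶ L)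
    (y : MackeyCategory.orbit H ⟶ MackeyCategory.orbit K) :
    orbitSingle f • sectionComponent H K y = 0 := by
  have : (DistribSMul.toAddMonoidHom _ (orbitSingle f)).toRatLinearMap ∘ₗ sectionComponent H K =
      0 := by
    refine MHom.hom_ext fun S => ?_
    rw [LinearMap.comp_apply, sectionComponent_cls]
    refine (Finset.smul_sum (r := orbitSingle f)).trans (Finset.sum_eq_zero fun v _ => ?_)
    exact orbitSingle_smul_sectionTerm_of_ne h f _ _ _ _ _
  exact LinearMap.congr_fun this y

theorem sectionAddHom_orbitSingle_smul {K L : Orb G} (f : K ⟶ L) (m : MackeyAlgebra G) :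
    sectionAddHom G (orbitSingle f • m) = orbitSingle f • sectionAddHom G m := by
  have : (sectionAddHom G).comp (DistribSMul.toAddMonoidHom _ (orbitSingle f)) =
      (DistribSMul.toAddMonoidHom _ (orbitSingle f)).comp (sectionAddHom G) := by
    refine CategoryAlgebra.addHom_ext fun H K' y => ?_
    simp only [AddMonoidHom.comp_apply, DistribSMul.toAddMonoidHom_apply, MackeyAlgebra.smul_def,
      orbitToMackey_orbitSingle, sectionAddHom_single]
    by_cases h : K' = K
    · subst h
      rw [CategoryAlgebra.single_mul_single, sectionAddHom_single, sectionComponent_comp]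
    · rw [CategoryAlgebra.single_mul_single_of_ne h, map_zero,
        orbitSingle_smul_sectionComponent_of_ne h]
  exact DFunLike.congr_fun this m

theorem sectionAddHom_smul (a : OrbitAlgebra G) (m : MackeyAlgebra G) :
    sectionAddHom G (a • m) = a • sectionAddHom G m := by
  have : (sectionAddHom G).comp ((AddMonoidHom.flip (smulAddHom (OrbitAlgebra G) _)) m) =
      (AddMonoidHom.flip (smulAddHom (OrbitAlgebra G) _)) (sectionAddHom G m) := by
    refine CategoryAlgebra.addHom_ext fun K L f => ?_
    have hf : ((sectionAddHom G).comp ((AddMonoidHom.flip (smulAddHom (OrbitAlgebra G) _)) m)).comp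
        (CategoryAlgebra.single (Free.of ℚ) K L) =
        ((AddMonoidHom.flip (smulAddHom (OrbitAlgebra G) _)) (sectionAddHom G m)).comp
          (CategoryAlgebra.single (Free.of ℚ) K L) := by
      refine AddMonoidHom.toRatLinearMap_injective (Orb.free_hom_ext fun f => ?_)
      exact sectionAddHom_orbitSingle_smul f m
    exact DFunLike.congr_fun hf f
  exact DFunLike.congr_fun this a

/-- The `ℚOr(G)`-linear section of the surjection from the free module on the set `μ_ℚ(G)` onto
`μ_ℚ(G)`. -/
noncomputable def mackeySection (G : Type u) [Group G] [Finite G] :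
    MackeyAlgebra G →ₗ[OrbitAlgebra G] (MackeyAlgebra G →₀ OrbitAlgebra G) where
  __ := sectionAddHom G
  map_smul' := sectionAddHom_smul

theorem linearCombination_sectionComponent {H K : Orb G}
    (y : MackeyCategory.orbit H ⟶ MackeyCategory.orbit K) :
    Finsupp.linearCombination (OrbitAlgebra G) id (sectionComponent H K y) =
      CategoryAlgebra.single MackeyCategory.orbit H K y := by
  have : (Finsupp.linearCombination (OrbitAlgebra G)
        (id : MackeyAlgebra G → _)).toAddMonoidHom.toRatLinearMap ∘ₗ sectionComponent H K =
      (CategoryAlgebra.single MackeyCategory.orbit H K).toRatLinearMap := by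
    refine MHom.hom_ext fun S => ?_
    rw [LinearMap.comp_apply, sectionComponent_cls]
    rw [← stabSum_ofPoints S]
    refine (map_sum (Finsupp.linearCombination (OrbitAlgebra G) id) _ _).trans
      (Eq.trans ?_ (map_sum (CategoryAlgebra.single MackeyCategory.orbit H K) _ _).symm)
    refine Finset.sum_congr rfl fun v _ => ?_
    exact linearCombination_sectionTerm H K _ _ _ _ _
  exact LinearMap.congr_fun this y

theorem linearCombination_sectionAddHom (m : MackeyAlgebra G) :
    Finsupp.linearCombination (OrbitAlgebra G) id (sectionAddHom G m) = m := by
  have : (Finsupp.linearCombination (OrbitAlgebra G)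
      (id : MackeyAlgebra G → _)).toAddMonoidHom.comp (sectionAddHom G) = AddMonoidHom.id _ := by
    refine CategoryAlgebra.addHom_ext fun H K y => ?_
    rw [AddMonoidHom.comp_apply, sectionAddHom_single]
    exact linearCombination_sectionComponent y
  exact DFunLike.congr_fun this m

end

theorem mainTheorem9 (G : Type u) [Group G] [Finite G] :
    Module.Projective (OrbitAlgebra G) (MackeyAlgebra G) :=
  ⟨mackeySection G, linearCombination_sectionAddHom⟩
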